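/- For $n\ge 0$ let $Q_n$ be the Boolean lattice of dimension $n$, i.e. the set of all subsets of an $n$-element set ordered by inclusion. A blue/red coloring of a poset assigns to each of its elements one of the colors blue and red. A copy of a colored poset $\dot P$ (a poset $P$ with a fixed blue/red coloring) in a colored poset $Q$ is the image of a map $\phi\colon P\to Q$ such that $X\le_P Y\iff \phi(X)\le_Q\phi(Y)$ for all $X,Y\in P$, and $\phi(X)$ has the same color as $X$ for every $X\in P$. A blue (red) copy of an uncolored poset is a copy of this poset with all elements colored blue (red). The poset Erdős–Hajnal number $\widetilde R(\dot P,Q_n)$ is the smallest $N$ such that every blue/red coloring of $Q_N$ contains a copy of $\dot P$, a blue copy of $Q_n$, or a red copy of $Q_n$. The poset Ramsey number $R(P,Q)$ of posets $P,Q$ is the smallest $N$ such that every blue/red coloring of $Q_N$ contains a blue copy of $P$ or a red copy of $Q$. Let $\dot C_t^{(rbr)}$ be the red-alternating chain of length $t$, i.e. the chain $Z_1<\dots<Z_t$ on $t$ elements colored alternatingly red and blue, with the minimal element $Z_1$ red. **Theorem.** 1. For every $n$, $\widetilde R(\dot C_2^{(rbr)},Q_n)=\widetilde R(\dot C_3^{(rbr)},Q_n)=2n$.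 2. There is an $n_0$ such that for all $t\ge 4$ and all $n\ge n_0$, $$2.02\,n<\widetilde R(\dot C_t^{(rbr)},Q_n)\le (t-1)n.$$ 3. There is an $n_0$ such that $R(Q_n,Q_n)>2.02\,n$ for all $n\ge n_0$. -/

import Mathlib

/-- The two colors. -/
inductive Color : Type
  | blue
  | red

/-- The Boolean lattice of dimension `n`: all subsets of an `n`-element ground set, ordered by
inclusion. -/
abbrev BooleanLattice (n : ℕ) : Type := Finset (Fin n)

/-- Let `cP` and `cQ` be blue/red colorings of the posets `P` and `Q`. The colored poset `(Q, cQ)`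
contains a (colored, induced) copy of the colored poset `(P, cP)`: there is a map `φ : P → Q` with
`x ≤ y ↔ φ x ≤ φ y` that preserves colors. -/
def HasColoredCopy {P Q : Type*} [PartialOrder P] [PartialOrder Q]
    (cP : P → Color) (cQ : Q → Color) : Prop :=
  ∃ φ : P ↪o Q, ∀ x : P, cQ (φ x) = cP x

/-- The monochromatic coloring of `P` with color `a`. -/
def monoColoring (P : Type*) (a : Color) : P → Color := fun _ => a

/-- The poset Ramsey number `R(P, Q)`: the smallest `N` such that every blue/red coloring of the
`N`-dimensional Boolean lattice contains a blue induced copy of `P` or a red induced copy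
of `Q`. -/
noncomputable def posetRamsey (P Q : Type*) [PartialOrder P] [PartialOrder Q] : ℕ :=
  sInf {N : ℕ | ∀ c : BooleanLattice N → Color,
    HasColoredCopy (monoColoring P Color.blue) c ∨ HasColoredCopy (monoColoring Q Color.red) c}

/-- The poset Erdős–Hajnal number of a colored poset `(P, cP)` versus `Q_n`: the smallest `N` such
that every blue/red coloring of the `N`-dimensional Boolean lattice contains a copy of `(P, cP)`, a
blue copy of `Q_n`, or a red copy of `Q_n`. -/
noncomputable def posetErdosHajnal {P : Type*} [PartialOrder P] (cP : P → Color) (n : ℕ) : ℕ :=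
  sInf {N : ℕ | ∀ c : BooleanLattice N → Color,
    HasColoredCopy cP c ∨
    HasColoredCopy (monoColoring (BooleanLattice n) Color.blue) c ∨
    HasColoredCopy (monoColoring (BooleanLattice n) Color.red) c}

/-- The coloring of the red-alternating chain of length `t`: the underlying poset is the chain
`Fin t` on `t` vertices, colored alternatingly, with red minimal vertex `0`. -/
def redAlternatingChain (t : ℕ) : Fin t → Color :=
  fun i => if Even (i : ℕ) then Color.red else Color.blue

/-! Upper bounds: assume that there is no monochromatic copy of `Q_n`. Every interval of dimension
`n` then contains both colors, so an alternating chain can be lengthened by one element at the cost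
of `n` coordinates. A two-block argument (`exists_alternating_triple`) gets three alternating
elements out of only `2n` coordinates; this saves one block and gives `(t - 1) n`.

Lower bounds: a copy of `Q_n` has a trace, an `n`-set `X` such that the image of `S` meets `X`
exactly in the part indexed by `S` (`exists_trace`). Coloring the layers below `n` blue and the
others red gives `2n`.

For `2.02 n`, work in dimension `65m` with `n = 32m`. Sets of size below `16m` are blue and sets of
size above `49m` are red. In between, a set is red exactly when it lies below a `33m`-set of a
random family `H`. Red thus forms a down-set within the sizes from `16m` to `49m`, so no chain is
colored red, blue, red, blue. The properties of `H` in `exists_separating_family` destroy both kinds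
of monochromatic copy, and a first-moment count provides `H`. Since `65/32 > 2.02`, rounding is
harmless for large `n`. -/

/-- The color different from a given one. -/
def Color.other : Color → Color
  | .blue => .red
  | .red => .blue

theorem Color.eq_other_of_ne {a b : Color} (h : a ≠ b) : a = b.other := by
  cases a <;> cases b <;> simp_all [Color.other]

theorem Color.other_other (a : Color) : a.other.other = a := by
  cases a <;> rfl

/-! ### Transport and construction of copies -/

theorem HasColoredCopy.comp {P Q Q' : Type*} [PartialOrder P] [PartialOrder Q] [PartialOrder Q']
    {cP : P → Color} {c : Q' → Color} (ψ : Q ↪o Q')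
    (h : HasColoredCopy cP (fun x => c (ψ x))) : HasColoredCopy cP c := by
  obtain ⟨φ, hφ⟩ := h
  exact ⟨φ.trans ψ, hφ⟩

theorem HasColoredCopy.of_pattern {P P' Q : Type*} [PartialOrder P] [PartialOrder P']
    [PartialOrder Q] {cP : P → Color} {cP' : P' → Color} {c : Q → Color} (ψ : P ↪o P')
    (hψ : ∀ x, cP' (ψ x) = cP x) (h : HasColoredCopy cP' c) : HasColoredCopy cP c := by
  obtain ⟨φ, hφ⟩ := h
  exact ⟨ψ.trans φ, fun x => (hφ (ψ x)).trans (hψ x)⟩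

/-- The embedding of Boolean lattices induced by the inclusion of ground sets. -/
def booleanLatticeCastLE {m n : ℕ} (h : m ≤ n) : BooleanLattice m ↪o BooleanLattice n :=
  Finset.mapEmbedding (Fin.castLEEmb h)

theorem hasColoredCopy_mono_of_le {m n : ℕ} (h : m ≤ n) {Q : Type*} [PartialOrder Q]
    {c : Q → Color} {κ : Color} (hc : HasColoredCopy (monoColoring (BooleanLattice n) κ) c) :
    HasColoredCopy (monoColoring (BooleanLattice m) κ) c :=
  hc.of_pattern (booleanLatticeCastLE h) fun _ => rfl

theorem hasColoredCopy_chain_of_le {s t : ℕ} (h : s ≤ t) {Q : Type*} [PartialOrder Q]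
    {c : Q → Color} (hc : HasColoredCopy (redAlternatingChain t) c) :
    HasColoredCopy (redAlternatingChain s) c :=
  hc.of_pattern (Fin.castLEOrderEmb h) fun _ => rfl

/-- The part `g S` avoids the coordinates selected by `e`, so `S` can be read off from its image;
this reflects the order, whatever monotone `g` is. -/
theorem hasColoredCopy_of_monotone {n N : ℕ} (e : Fin n ↪ Fin N)
    (g : Finset (Fin n) → Finset (Fin N)) (hg : Monotone g) (hdisj : ∀ S i, e i ∉ g S)
    {c : BooleanLattice N → Color} {κ : Color} (hc : ∀ S, c (S.map e ∪ g S) = κ) :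
    HasColoredCopy (monoColoring (BooleanLattice n) κ) c := by
  refine ⟨OrderEmbedding.ofMapLEIff (fun S => S.map e ∪ g S) ?_, hc⟩
  intro S T
  constructor
  · intro h i hi
    have h1 : e i ∈ T.map e ∪ g T := h (by simp [hi])
    rcases Finset.mem_union.1 h1 with h2 | h2
    · simpa using h2
    · exact absurd h2 (hdisj T i)
  · intro h
    exact Finset.union_subset_union (Finset.map_subset_map.2 h) (hg h)

theorem exists_embedding_range {n N : ℕ} {X : Finset (Fin N)} (hX : X.card = n) :
    ∃ e : Fin n ↪ Fin N, Finset.univ.map e = X :=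
  ⟨(X.orderEmbOfFin hX).toEmbedding, by
    ext x
    simp⟩

/-- If no element of the interval between `A` and `A ∪ X` has color `κ`, there is a copy of the
Boolean lattice of dimension `#X` in the other color. -/
theorem exists_color_of_interval {n N : ℕ} (c : BooleanLattice N → Color) (κ : Color)
    {A X : Finset (Fin N)} (hX : X.card = n) (hAX : Disjoint X A)
    (h : ¬ HasColoredCopy (monoColoring (BooleanLattice n) κ.other) c) :
    ∃ Z, A ⊆ Z ∧ Z ⊆ A ∪ X ∧ c Z = κ := by
  by_contra! hcon
  obtain ⟨e, he⟩ := exists_embedding_range hX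
  have hmem : ∀ i, e i ∈ X := fun i => by rw [← he]; simp
  refine h (hasColoredCopy_of_monotone e (fun _ => A) monotone_const
    (fun S i => Finset.disjoint_left.1 hAX (hmem i)) fun S => Color.eq_other_of_ne ?_)
  refine hcon _ Finset.subset_union_right ?_
  refine Finset.union_subset (fun x hx => ?_) Finset.subset_union_left
  obtain ⟨i, -, rfl⟩ := Finset.mem_map.1 hx
  exact Finset.mem_union_right _ (hmem i)

/-! ### Upper bounds: alternating chains -/

/-- Lift each `S` along `X`, adding `Y` exactly when color `κ` already occurs between `A` and the
lower lift. The condition is upward closed, so this is a copy of the lattice. As it is not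
monochromatic in `κ.other`, some `S` has color `κ` both weakly below its lower lift and weakly above
its upper lift; the interval between the two lifts supplies the middle element. -/
theorem exists_alternating_triple {n N : ℕ} (c : BooleanLattice N → Color) (κ : Color)
    {A X Y : Finset (Fin N)} (hX : X.card = n) (hY : Y.card = n) (hXA : Disjoint X A)
    (hYA : Disjoint Y A) (hXY : Disjoint X Y)
    (h : ∀ κ', ¬ HasColoredCopy (monoColoring (BooleanLattice n) κ') c) :
    ∃ Z₁ Z₂ Z₃, A ⊆ Z₁ ∧ Z₁ ⊆ Z₂ ∧ Z₂ ⊆ Z₃ ∧ c Z₁ = κ ∧ c Z₂ = κ.other ∧ c Z₃ = κ := by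
  by_contra! hcon
  obtain ⟨e, he⟩ := exists_embedding_range hX
  have hmem : ∀ i, e i ∈ X := fun i => by rw [← he]; simp
  -- `p S` says that some element of color `κ` lies between `A` and the lower lift of `S`
  let p : Finset (Fin n) → Prop := fun S => ∃ Z, A ⊆ Z ∧ Z ⊆ S.map e ∪ A ∧ c Z = κ
  have hp : ∀ {S T}, S ⊆ T → p S → p T := by
    rintro S T hST ⟨Z, h1, h2, h3⟩
    exact ⟨Z, h1, h2.trans (Finset.union_subset_union (Finset.map_subset_map.2 hST) subset_rfl), h3⟩
  classical
  by_cases hS : ∃ S, p S ∧ ∃ Z, S.map e ∪ (A ∪ Y) ⊆ Z ∧ c Z = κ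
  · obtain ⟨S, ⟨Z₁, hA, hZ₁, hc₁⟩, Z₃, hZ₃, hc₃⟩ := hS
    have hd : Disjoint Y (S.map e ∪ A) := by
      refine Finset.disjoint_union_right.2 ⟨?_, hYA⟩
      refine Finset.disjoint_right.2 fun x hx => ?_
      obtain ⟨i, -, rfl⟩ := Finset.mem_map.1 hx
      exact Finset.disjoint_left.1 hXY (hmem i)
    obtain ⟨Z₂, h1, h2, h3⟩ := exists_color_of_interval c κ.other hY hd (h _)
    refine hcon Z₁ Z₂ Z₃ hA (hZ₁.trans h1) (h2.trans ?_) hc₁ h3 hc₃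
    rwa [Finset.union_assoc]
  · push Not at hS
    refine h κ.other (hasColoredCopy_of_monotone e (fun S => if p S then A ∪ Y else A) ?_ ?_ ?_)
    · intro S T hST
      by_cases h1 : p S
      · simp [h1, hp hST h1]
      · by_cases h2 : p T
        · simp [h1, h2]
        · simp [h1, h2]
    · intro S i
      have h1 := Finset.disjoint_left.1 hXA (hmem i)
      have h2 := Finset.disjoint_left.1 hXY (hmem i)
      split_ifs <;> simp [h1, h2]
    · intro S
      split_ifs with h1
      · exact Color.eq_other_of_ne (hS S h1 _ subset_rfl)
      · exact Color.eq_other_of_ne fun h2 => h1 ⟨_, Finset.subset_union_right, subset_rfl, h2⟩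

/-- The alternating sequence of colors starting with `κ`. -/
def alternatingColor (κ : Color) (i : ℕ) : Color := if Even i then κ else κ.other

theorem alternatingColor_succ (κ : Color) (i : ℕ) :
    alternatingColor κ (i + 1) = alternatingColor κ.other i := by
  by_cases h : Even i <;> simp [alternatingColor, h, Nat.even_add_one, Color.other_other]

/-- Induction from the triple: one block of `n` coordinates provides a new bottom element, and the
rest of the chain is built above the top of that block. Only weak inclusions are recorded, since the
change of color makes them strict. -/
theorem exists_alternating_chain {n N : ℕ} (c : BooleanLattice N → Color)
    (h : ∀ κ', ¬ HasColoredCopy (monoColoring (BooleanLattice n) κ') c) (t : ℕ) :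
    ∀ (κ : Color) (A : Finset (Fin N)), (t + 2) * n ≤ Aᶜ.card →
      ∃ z : ℕ → Finset (Fin N), (∀ i, A ⊆ z i) ∧ (∀ i < t + 2, z i ⊆ z (i + 1)) ∧
        ∀ i < t + 3, c (z i) = alternatingColor κ i := by
  induction t with
  | zero =>
    intro κ A hA
    obtain ⟨X, hX, hXn⟩ := Finset.exists_subset_card_eq (show n ≤ Aᶜ.card by omega)
    have h2 : n ≤ (Aᶜ \ X).card := by rw [Finset.card_sdiff_of_subset hX]; omega
    obtain ⟨Y, hY, hYn⟩ := Finset.exists_subset_card_eq h2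
    have hXA : Disjoint X A := Finset.disjoint_left.2 fun x hx => Finset.mem_compl.1 (hX hx)
    have hYA : Disjoint Y A := Finset.disjoint_left.2 fun x hx =>
      Finset.mem_compl.1 (Finset.mem_sdiff.1 (hY hx)).1
    have hXY : Disjoint X Y := Finset.disjoint_right.2 fun x hx => (Finset.mem_sdiff.1 (hY hx)).2
    obtain ⟨Z₁, Z₂, Z₃, h1, h12, h23, c1, c2, c3⟩ :=
      exists_alternating_triple c κ hXn hYn hXA hYA hXY h
    refine ⟨fun i => if i = 0 then Z₁ else if i = 1 then Z₂ else Z₃, ?_, ?_, ?_⟩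
    · intro i
      dsimp only
      split_ifs
      exacts [h1, h1.trans h12, (h1.trans h12).trans h23]
    · intro i hi
      interval_cases i
      exacts [h12, h23]
    · intro i hi
      interval_cases i <;> simp [alternatingColor, c1, c2, c3]
  | succ t ih =>
    intro κ A hA
    obtain ⟨X, hX, hXn⟩ := Finset.exists_subset_card_eq
      (show n ≤ Aᶜ.card from le_trans (by nlinarith) hA)
    have hXA : Disjoint X A := Finset.disjoint_left.2 fun x hx => Finset.mem_compl.1 (hX hx)
    obtain ⟨Z, h1, h2, h3⟩ := exists_color_of_interval c κ hXn hXA (h _)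
    obtain ⟨z, hz1, hz2, hz3⟩ := ih κ.other (A ∪ X) (by
      rw [Finset.compl_union, ← Finset.sdiff_eq_inter_compl, Finset.card_sdiff_of_subset hX, hXn]
      have : (t + 1 + 2) * n = (t + 2) * n + n := by ring
      omega)
    refine ⟨fun i => Nat.casesOn i Z z, ?_, ?_, ?_⟩
    · rintro (_ | i)
      · exact h1
      · exact Finset.subset_union_left.trans (hz1 i)
    · rintro (_ | i) hi
      · exact h2.trans (hz1 0)
      · exact hz2 i (by omega)
    · rintro (_ | i) hi
      · simpa [alternatingColor] using h3
      · rw [alternatingColor_succ]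
        exact hz3 i (by omega)

theorem hasColoredCopy_redAlternatingChain_or_mono (t n : ℕ)
    (c : BooleanLattice ((t + 2) * n) → Color) :
    HasColoredCopy (redAlternatingChain (t + 3)) c ∨
    HasColoredCopy (monoColoring (BooleanLattice n) Color.blue) c ∨
    HasColoredCopy (monoColoring (BooleanLattice n) Color.red) c := by
  by_contra! hcon
  have h : ∀ κ', ¬ HasColoredCopy (monoColoring (BooleanLattice n) κ') c := by
    rintro (_ | _)
    exacts [hcon.2.1, hcon.2.2]
  obtain ⟨z, -, hz2, hz3⟩ := exists_alternating_chain c h t Color.red ∅ (by simp)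
  refine hcon.1 ⟨OrderEmbedding.ofStrictMono (fun i : Fin (t + 3) => z i) ?_, ?_⟩
  · refine Fin.strictMono_iff_lt_succ.2 fun i => ?_
    refine (hz2 i i.2).ssubset_of_ne fun heq => ?_
    have h1 := hz3 i (by omega)
    have h2 := hz3 (i + 1) (by omega)
    rw [← heq, h1, alternatingColor_succ] at h2
    revert h2
    by_cases he : Even (i : ℕ) <;> simp [alternatingColor, he, Color.other]
  · intro i
    exact hz3 i i.2

theorem posetErdosHajnal_redAlternatingChain_le (t n : ℕ) :
    posetErdosHajnal (redAlternatingChain (t + 3)) n ≤ (t + 2) * n :=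
  Nat.sInf_le (hasColoredCopy_redAlternatingChain_or_mono t n)

/-! ### Traces of copies and the lower bound `2n` -/

/-- A copy of the Boolean lattice of dimension `n` is traced out by an `n`-element set. -/
theorem exists_trace {n N : ℕ} (φ : BooleanLattice n ↪o BooleanLattice N) :
    ∃ x : Fin n ↪ Fin N, ∀ S i, x i ∈ φ S ↔ i ∈ S := by
  have h : ∀ i : Fin n, ∃ x, x ∈ φ {i} ∧ x ∉ φ {i}ᶜ := by
    intro i
    have h1 : ¬ φ {i} ≤ φ {i}ᶜ := by
      rw [φ.le_iff_le]
      intro h2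
      have := h2 (Finset.mem_singleton_self i)
      simp at this
    exact Finset.not_subset.1 h1
  choose x hx1 hx2 using h
  have key : ∀ S i, x i ∈ φ S ↔ i ∈ S := by
    intro S i
    constructor
    · intro h1
      by_contra h2
      refine hx2 i (φ.monotone ?_ h1)
      intro j hj
      simp only [Finset.mem_compl, Finset.mem_singleton]
      rintro rfl
      exact h2 hj
    · intro h1
      exact φ.monotone (Finset.singleton_subset_iff.2 h1) (hx1 i)
  refine ⟨⟨x, fun i j hij => ?_⟩, key⟩
  have hj : x j ∈ φ {i} := (show x i = x j from hij) ▸ hx1 i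
  exact (Finset.mem_singleton.1 ((key {i} j).1 hj)).symm

theorem map_trace_subset {n N : ℕ} {φ : BooleanLattice n ↪o BooleanLattice N}
    {x : Fin n ↪ Fin N} (hx : ∀ S i, x i ∈ φ S ↔ i ∈ S) (S : Finset (Fin n)) :
    S.map x ⊆ φ S := by
  intro y hy
  obtain ⟨i, hi, rfl⟩ := Finset.mem_map.1 hy
  exact (hx S i).2 hi

theorem card_add_card_compl_le {n N : ℕ} {φ : BooleanLattice n ↪o BooleanLattice N}
    {x : Fin n ↪ Fin N} (hx : ∀ S i, x i ∈ φ S ↔ i ∈ S) (S : Finset (Fin n)) :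
    (φ S).card + Sᶜ.card ≤ N := by
  have hd : Disjoint (φ S) (Sᶜ.map x) := by
    refine Finset.disjoint_right.2 fun y hy => ?_
    obtain ⟨i, hi, rfl⟩ := Finset.mem_map.1 hy
    rw [hx]
    exact Finset.mem_compl.1 hi
  rw [← Finset.card_map x, ← Finset.card_union_of_disjoint hd]
  exact (Finset.card_le_univ _).trans (by simp)

/-- With the layers below `n` blue and the rest red, no red set lies below a blue one. The top of a
copy contains its trace and so has at least `n` elements; a red bottom has at least `n` elements and
misses the trace, forcing `2n ≤ N`. Nonemptiness is needed because `sInf ∅ = 0`. -/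
theorem two_mul_le_posetErdosHajnal {t : ℕ} (ht : 2 ≤ t) (n : ℕ)
    (hne : {N : ℕ | ∀ c : BooleanLattice N → Color,
      HasColoredCopy (redAlternatingChain t) c ∨
      HasColoredCopy (monoColoring (BooleanLattice n) Color.blue) c ∨
      HasColoredCopy (monoColoring (BooleanLattice n) Color.red) c}.Nonempty) :
    2 * n ≤ posetErdosHajnal (redAlternatingChain t) n := by
  have hmem := Nat.sInf_mem hne
  change 2 * n ≤ sInf {N : ℕ | _}
  generalize sInf {N : ℕ | _} = N at hmem ⊢
  rcases hmem fun Z => if Z.card < n then Color.blue else Color.red with h | ⟨φ, hφ⟩ | ⟨φ, hφ⟩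
  · obtain ⟨φ, hφ⟩ := hasColoredCopy_chain_of_le ht h
    have h0 := hφ 0
    have h1 := hφ 1
    have h01 := Finset.card_le_card (φ.monotone (show (0 : Fin 2) ≤ 1 by simp))
    simp [redAlternatingChain] at h0 h1
    omega
  · obtain ⟨x, hx⟩ := exists_trace φ
    have h1 := Finset.card_le_card (map_trace_subset hx Finset.univ)
    have h2 := hφ Finset.univ
    simp [monoColoring] at h1 h2
    omega
  · obtain ⟨x, hx⟩ := exists_trace φ
    have h1 := card_add_card_compl_le hx ∅
    have h2 := hφ ∅
    simp [monoColoring] at h1 h2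
    omega

/-! ### Finiteness of the diagonal Ramsey number -/

/-- Blow-up argument: besides `x`, take blocks `y 0, ..., y n` of size `n`. For `S` of size `s`,
pick a blue set in the interval that starts at `S` with the blocks before `s` and is spanned by
block `s`. For larger sets the interval starts above the end of this one, so the choices are
monotone. -/
theorem exists_posetRamsey_bound (n : ℕ) : ∃ N : ℕ, ∀ c : BooleanLattice N → Color,
    HasColoredCopy (monoColoring (BooleanLattice n) Color.blue) c ∨
    HasColoredCopy (monoColoring (BooleanLattice n) Color.red) c := by
  classical
  let α := Fin n ⊕ Fin (n + 1) × Fin n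
  let e : α ≃ Fin (Fintype.card α) := Fintype.equivFin α
  refine ⟨Fintype.card α, fun c => ?_⟩
  by_contra! hcon
  let x : Fin n ↪ Fin (Fintype.card α) := ⟨fun i => e (Sum.inl i), fun i j h => Sum.inl.inj (e.injective h)⟩
  let y : Fin (n + 1) → Fin n ↪ Fin (Fintype.card α) :=
    fun k => ⟨fun i => e (Sum.inr (k, i)), fun i j h => (Prod.mk.inj (Sum.inr.inj (e.injective h))).2⟩
  have hxy : ∀ i k j, x i ≠ y k j := fun i k j h => by cases e.injective h
  have hyy : ∀ k k' i j, y k i = y k' j → k = k' := fun k k' i j h =>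
    (Prod.mk.inj (Sum.inr.inj (e.injective h))).1
  let low : ℕ → Finset (Fin (Fintype.card α)) := fun s =>
    (Finset.univ.filter fun k : Fin (n + 1) => (k : ℕ) < s).biUnion fun k => Finset.univ.map (y k)
  have hk : ∀ S : Finset (Fin n), S.card < n + 1 := fun S =>
    Nat.lt_succ_of_le ((Finset.card_le_univ S).trans (by simp))
  have key : ∀ S : Finset (Fin n), ∃ Z, S.map x ∪ low S.card ⊆ Z ∧
      Z ⊆ S.map x ∪ low S.card ∪ Finset.univ.map (y ⟨S.card, hk S⟩) ∧ c Z = Color.blue := by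
    intro S
    refine exists_color_of_interval c Color.blue (by simp) ?_ hcon.2
    refine Finset.disjoint_left.2 fun w hw => ?_
    obtain ⟨i, -, rfl⟩ := Finset.mem_map.1 hw
    simp only [low, Finset.mem_union, Finset.mem_map, Finset.mem_biUnion, Finset.mem_filter]
    rintro (⟨j, -, hj⟩ | ⟨k, ⟨-, hk'⟩, j, -, hj⟩)
    · exact hxy _ _ _ hj
    · rw [hyy _ _ _ _ hj] at hk'
      exact lt_irrefl _ hk'
  choose Z hZ1 hZ2 hZ3 using key
  have hZx : ∀ S i, x i ∈ Z S ↔ i ∈ S := by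
    intro S i
    refine ⟨fun h => ?_, fun h => hZ1 S (Finset.mem_union_left _ (Finset.mem_map_of_mem x h))⟩
    have h1 := hZ2 S h
    simp only [low, Finset.mem_union, Finset.mem_map, Finset.mem_biUnion, Finset.mem_filter] at h1
    rcases h1 with (⟨j, hj, h2⟩ | ⟨k, -, j, -, h2⟩) | ⟨j, -, h2⟩
    · exact x.injective h2 ▸ hj
    · exact absurd h2.symm (hxy _ _ _)
    · exact absurd h2.symm (hxy _ _ _)
  have hmono : ∀ S T, S ⊂ T → Z S ⊆ Z T := by
    intro S T hST
    have hcard := Finset.card_lt_card hST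
    refine (hZ2 S).trans (subset_trans ?_ (hZ1 T))
    refine Finset.union_subset (Finset.union_subset_union
      (Finset.map_subset_map.2 hST.1) ?_) ?_
    · refine Finset.biUnion_subset_biUnion_of_subset_left _ fun k hk' => ?_
      simp only [Finset.mem_filter, Finset.mem_univ, true_and] at hk' ⊢
      omega
    · refine subset_trans ?_ Finset.subset_union_right
      exact Finset.subset_biUnion_of_mem (fun k => Finset.univ.map (y k))
        (Finset.mem_filter.2 ⟨Finset.mem_univ _, hcard⟩)
  refine hcon.1 ⟨OrderEmbedding.ofMapLEIff Z fun S T => ⟨fun h i hi => ?_, fun h => ?_⟩, hZ3⟩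
  · exact (hZx T i).1 (h ((hZx S i).2 hi))
  · rcases eq_or_ssubset_of_subset h with rfl | h
    · exact le_rfl
    · exact hmono S T h

/-! ### First-moment method by counting functions -/

theorem card_filter_forall_ne_zero {L : Type*} [Fintype L] [DecidableEq L] (q : ℕ) [NeZero q]
    (I : Finset L) :
    ((Fintype.piFinset fun z : L => if z ∈ I then Finset.univ.erase (0 : Fin q)
      else Finset.univ).card : ℝ) = (q : ℝ) ^ Fintype.card L * (1 - 1 / q : ℝ) ^ I.card := by
  have hq : (q : ℝ) ≠ 0 := by exact_mod_cast NeZero.ne q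
  rw [Fintype.card_piFinset]
  push_cast
  have h1 : ∀ z : L, (((if z ∈ I then Finset.univ.erase (0 : Fin q)
      else Finset.univ).card : ℕ) : ℝ) = q * (if z ∈ I then (1 - 1 / q : ℝ) else 1) := by
    intro z
    split_ifs
    · rw [Finset.card_erase_of_mem (Finset.mem_univ _), Finset.card_univ, Fintype.card_fin,
        Nat.cast_sub (Nat.one_le_iff_ne_zero.2 (NeZero.ne q))]
      push_cast
      field_simp
    · simp
  simp_rw [h1]
  rw [Finset.prod_mul_distrib, Finset.prod_const, Finset.card_univ, Finset.prod_ite_mem]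
  simp

theorem card_filter_forall_eq_zero {L : Type*} [Fintype L] [DecidableEq L] (q : ℕ) [NeZero q]
    (K : Finset L) :
    ((Fintype.piFinset fun z : L => if z ∈ K then {(0 : Fin q)}
      else Finset.univ).card : ℝ) = (q : ℝ) ^ Fintype.card L * (1 / q : ℝ) ^ K.card := by
  have hq : (q : ℝ) ≠ 0 := by exact_mod_cast NeZero.ne q
  rw [Fintype.card_piFinset]
  push_cast
  have h1 : ∀ z : L, (((if z ∈ K then {(0 : Fin q)}
      else Finset.univ).card : ℕ) : ℝ) = q * (if z ∈ K then (1 / q : ℝ) else 1) := by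
    intro z
    split_ifs <;> simp [hq]
  simp_rw [h1]
  rw [Finset.prod_mul_distrib, Finset.prod_const, Finset.card_univ, Finset.prod_ite_mem]
  simp

/-- A first-moment bound: a random subset of density `1 / q` meets all sets of a family of large
sets and, for each tuple of disjoint small sets of another family, misses a member of the tuple. -/
theorem exists_set_hitting_and_missing {L ι₁ ι₂ : Type*} [Fintype L] [DecidableEq L]
    (s₁ : Finset ι₁) (s₂ : Finset ι₂) {k q s D : ℕ} (hq : 0 < q)
    (I : ι₁ → Finset L) (U : ι₂ → Fin k → Finset L)
    (hI : ∀ i ∈ s₁, s ≤ (I i).card) (hU : ∀ j ∈ s₂, ∀ l, (U j l).card ≤ D)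
    (hdis : ∀ j ∈ s₂, ∀ l l', l ≠ l' → Disjoint (U j l) (U j l'))
    (h : (s₁.card : ℝ) * (1 - 1 / q : ℝ) ^ s + s₂.card * (D / q : ℝ) ^ k < 1) :
    ∃ H : Finset L, (∀ i ∈ s₁, ∃ z ∈ I i, z ∈ H) ∧ ∀ j ∈ s₂, ∃ l, ∀ z ∈ U j l, z ∉ H := by
  classical
  have : NeZero q := ⟨hq.ne'⟩
  have hq' : (1 : ℝ) ≤ q := by exact_mod_cast hq
  by_contra! hcon
  -- The random set is the zero set of a uniform `f : L → Fin q`. `B₁` and `B₂` collect the bad `f`: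
  -- those with no zero on `I i`, and those with a zero `u l` in every `U j l`. Disjointness makes
  -- the `u l` distinct, whence the factor `(1 / q) ^ k`.
  let B₁ : ι₁ → Finset (L → Fin q) := fun i =>
    Fintype.piFinset fun z : L => if z ∈ I i then Finset.univ.erase (0 : Fin q) else Finset.univ
  let B₂ : ι₂ → Finset (L → Fin q) := fun j =>
    (Fintype.piFinset (U j)).biUnion fun u => Fintype.piFinset fun z : L =>
      if z ∈ Finset.univ.image u then {(0 : Fin q)} else Finset.univ
  have hcover : (Finset.univ : Finset (L → Fin q)) ⊆ s₁.biUnion B₁ ∪ s₂.biUnion B₂ := by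
    intro f _
    by_cases h1 : ∀ i ∈ s₁, ∃ z ∈ I i, z ∈ Finset.univ.filter fun z => f z = 0
    · obtain ⟨j, hj, hu⟩ := hcon _ h1
      choose u hu1 hu2 using hu
      refine Finset.mem_union_right _ (Finset.mem_biUnion.2 ⟨j, hj, ?_⟩)
      refine Finset.mem_biUnion.2 ⟨u, Fintype.mem_piFinset.2 hu1, Fintype.mem_piFinset.2 ?_⟩
      intro z
      split_ifs with hz
      · obtain ⟨l, -, rfl⟩ := Finset.mem_image.1 hz
        simpa using hu2 l
      · exact Finset.mem_univ _
    · push Not at h1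
      obtain ⟨i, hi, h2⟩ := h1
      refine Finset.mem_union_left _ (Finset.mem_biUnion.2 ⟨i, hi, Fintype.mem_piFinset.2 ?_⟩)
      intro z
      split_ifs with hz
      · simpa using h2 z hz
      · exact Finset.mem_univ _
  have hB₁ : ∀ i ∈ s₁, ((B₁ i).card : ℝ) ≤
      (q : ℝ) ^ Fintype.card L * (1 - 1 / q : ℝ) ^ s := by
    intro i hi
    rw [card_filter_forall_ne_zero]
    refine mul_le_mul_of_nonneg_left (pow_le_pow_of_le_one ?_ ?_ (hI i hi)) (by positivity)
    · rw [sub_nonneg, div_le_one (by linarith)]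
      exact hq'
    · rw [sub_le_self_iff]
      positivity
  have hB₂ : ∀ j ∈ s₂, ((B₂ j).card : ℝ) ≤
      (q : ℝ) ^ Fintype.card L * (D / q : ℝ) ^ k := by
    intro j hj
    have h1 : ∀ u ∈ Fintype.piFinset (U j), ((Fintype.piFinset fun z : L =>
        if z ∈ Finset.univ.image u then {(0 : Fin q)} else Finset.univ).card : ℝ) =
        (q : ℝ) ^ Fintype.card L * (1 / q : ℝ) ^ k := by
      intro u hu
      rw [card_filter_forall_eq_zero, Finset.card_image_of_injective, Finset.card_univ,
        Fintype.card_fin]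
      intro l l' hll
      by_contra hne
      have hu' := Fintype.mem_piFinset.1 hu
      exact Finset.disjoint_left.1 (hdis j hj l l' hne) (hu' l) (hll ▸ hu' l')
    have h2 : ((Fintype.piFinset (U j)).card : ℝ) ≤ (D : ℝ) ^ k := by
      rw [Fintype.card_piFinset]
      have : ∏ l, (U j l).card ≤ ∏ _l : Fin k, D := Finset.prod_le_prod' fun l _ => hU j hj l
      simp only [Finset.prod_const, Finset.card_univ, Fintype.card_fin] at this
      exact_mod_cast this
    calc ((B₂ j).card : ℝ) ≤ ∑ u ∈ Fintype.piFinset (U j), ((Fintype.piFinset fun z : L =>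
          if z ∈ Finset.univ.image u then {(0 : Fin q)} else Finset.univ).card : ℝ) := by
            exact_mod_cast Finset.card_biUnion_le
      _ = (Fintype.piFinset (U j)).card * ((q : ℝ) ^ Fintype.card L * (1 / q : ℝ) ^ k) := by
            rw [Finset.sum_congr rfl h1, Finset.sum_const, nsmul_eq_mul]
      _ ≤ (D : ℝ) ^ k * ((q : ℝ) ^ Fintype.card L * (1 / q : ℝ) ^ k) :=
            mul_le_mul_of_nonneg_right h2 (by positivity)
      _ = _ := by rw [div_pow, div_pow]; ring
  have hpos : (0 : ℝ) < (q : ℝ) ^ Fintype.card L := by positivity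
  have htot : (q : ℝ) ^ Fintype.card L ≤ s₁.card * ((q : ℝ) ^ Fintype.card L *
      (1 - 1 / q : ℝ) ^ s) + s₂.card * ((q : ℝ) ^ Fintype.card L * (D / q : ℝ) ^ k) := by
    calc (q : ℝ) ^ Fintype.card L = ((Finset.univ : Finset (L → Fin q)).card : ℝ) := by simp
      _ ≤ ((s₁.biUnion B₁ ∪ s₂.biUnion B₂).card : ℝ) := by
            exact_mod_cast Finset.card_le_card hcover
      _ ≤ ((s₁.biUnion B₁).card : ℝ) + ((s₂.biUnion B₂).card : ℝ) := by
            exact_mod_cast Finset.card_union_le _ _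
      _ ≤ (∑ i ∈ s₁, ((B₁ i).card : ℝ)) + ∑ j ∈ s₂, ((B₂ j).card : ℝ) :=
            add_le_add (by exact_mod_cast Finset.card_biUnion_le)
              (by exact_mod_cast Finset.card_biUnion_le)
      _ ≤ _ := by
            rw [← nsmul_eq_mul, ← nsmul_eq_mul]
            exact add_le_add (Finset.sum_le_card_nsmul _ _ _ hB₁)
              (Finset.sum_le_card_nsmul _ _ _ hB₂)
  have : (q : ℝ) ^ Fintype.card L * (s₁.card * (1 - 1 / q : ℝ) ^ s + s₂.card * (D / q : ℝ) ^ k) <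
      (q : ℝ) ^ Fintype.card L * 1 := mul_lt_mul_of_pos_left h hpos
  linarith [this, htot, mul_comm ((q : ℝ) ^ Fintype.card L) 1]

/-! ### Numerical estimates -/

/-- Compare one term of the expansion of `(1 + 32) ^ (33 * m)` with the whole sum and use `33 ^ 33 ≤
2 ^ 7 * 32 ^ 32`. -/
theorem choose_thirtyThree_mul_le (m : ℕ) : (33 * m).choose m ≤ 2 ^ (7 * m) := by
  have h1 : (33 * m).choose m * 32 ^ (33 * m - m) ≤ 33 ^ (33 * m) := by
    have h2 := add_pow (1 : ℕ) 32 (33 * m)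
    norm_num at h2
    rw [h2]
    have := Finset.single_le_sum (f := fun i => 32 ^ (33 * m - i) * (33 * m).choose i)
      (s := Finset.range (33 * m + 1)) (fun _ _ => Nat.zero_le _)
      (Finset.mem_range.2 (show m < 33 * m + 1 by omega))
    rw [mul_comm]
    exact this
  have h3 : 33 * m - m = 32 * m := by omega
  rw [h3] at h1
  have h4 : (33 : ℕ) ^ (33 * m) ≤ 2 ^ (7 * m) * 32 ^ (32 * m) := by
    rw [pow_mul, pow_mul, pow_mul, ← mul_pow]
    exact Nat.pow_le_pow_left (by norm_num) m
  exact Nat.le_of_mul_le_mul_right (h1.trans h4) (by positivity)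

theorem mul_sq_le_four_pow {m : ℕ} (hm : 100 ≤ m) : 4160 * m ^ 2 ≤ 4 ^ m := by
  induction m, hm using Nat.le_induction with
  | base => norm_num
  | succ m hm ih =>
    rw [pow_succ 4 m]
    nlinarith

/-- There are at most `4 ^ (65 * m)` intervals. The middle layer of each has at least `130 * m * q`
sets for `q = 2 ^ (30 * m)`, so the first term is at most `(4 / e ^ 2) ^ (65 * m)`. In the second,
each factor is at most `2 ^ (-23 * m)`; six of them beat `2 ^ (130 * m)`, whereas this bound with
five would not. -/
theorem four_pow_mul_add_lt_one {m : ℕ} (hm : 100 ≤ m) :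
    (4 : ℝ) ^ (65 * m) * (1 - 1 / ((2 ^ (30 * m) : ℕ) : ℝ)) ^ (32 * m).choose (16 * m) +
      4 ^ (65 * m) * (((33 * m).choose m : ℝ) / ((2 ^ (30 * m) : ℕ) : ℝ)) ^ 6 < 1 := by
  have hq : (0 : ℝ) < 2 ^ (30 * m) := by positivity
  have hchoose : (130 * m : ℝ) * 2 ^ (30 * m) ≤ ((32 * m).choose (16 * m) : ℝ) := by
    have h1 := Nat.four_pow_le_two_mul_self_mul_centralBinom (16 * m) (by omega)
    rw [Nat.centralBinom_eq_two_mul_choose, show 2 * (16 * m) = 32 * m by ring] at h1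
    have h2 : (4 : ℕ) ^ (16 * m) = 2 ^ (30 * m) * 4 ^ m := by
      rw [show (4 : ℕ) = 2 ^ 2 by norm_num, ← pow_mul, ← pow_mul, ← pow_add]
      congr 1
      ring
    have h3 := mul_sq_le_four_pow hm
    rw [h2] at h1
    have h4 : (32 * m) * (130 * m * 2 ^ (30 * m)) ≤ (32 * m) * (32 * m).choose (16 * m) := by
      refine le_trans ?_ h1
      calc (32 * m) * (130 * m * 2 ^ (30 * m)) = 2 ^ (30 * m) * (4160 * m ^ 2) := by ring
        _ ≤ _ := Nat.mul_le_mul_left _ h3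
    have h5 := Nat.le_of_mul_le_mul_left h4 (by omega)
    exact_mod_cast h5
  have hexp : (1 - 1 / ((2 ^ (30 * m) : ℕ) : ℝ)) ^ (32 * m).choose (16 * m) ≤
      Real.exp (-(130 * m)) := by
    push_cast
    have hle : (0 : ℝ) ≤ 1 - 1 / 2 ^ (30 * m) := by
      rw [sub_nonneg, div_le_one hq]
      exact one_le_pow₀ (by norm_num)
    calc _ ≤ (Real.exp (-(1 / 2 ^ (30 * m)))) ^ (32 * m).choose (16 * m) :=
          pow_le_pow_left₀ hle (Real.one_sub_le_exp_neg _) _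
      _ = Real.exp (-(((32 * m).choose (16 * m) : ℝ) / 2 ^ (30 * m))) := by
          rw [← Real.exp_nat_mul]
          congr 1
          ring
      _ ≤ _ := by
          refine Real.exp_le_exp.2 (neg_le_neg ?_)
          rwa [le_div_iff₀ hq]
  have hfirst : (4 : ℝ) ^ (65 * m) * (1 - 1 / ((2 ^ (30 * m) : ℕ) : ℝ)) ^
      (32 * m).choose (16 * m) ≤ 1 / 4 := by
    have h1 : Real.exp (-(130 * m)) = (Real.exp (-2)) ^ (65 * m) := by
      rw [← Real.exp_nat_mul]
      congr 1
      push_cast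
      ring
    have h2 : 4 * Real.exp (-2) ≤ 4 / 7 := by
      have h3 : (7 : ℝ) ≤ Real.exp 2 := by
        have h4 := Real.exp_one_gt_d9
        have h5 : Real.exp 2 = Real.exp 1 * Real.exp 1 := by
          rw [← Real.exp_add]
          norm_num
        nlinarith
      rw [Real.exp_neg, ← div_eq_mul_inv]
      exact div_le_div_of_nonneg_left (by norm_num) (by norm_num) h3
    calc _ ≤ (4 : ℝ) ^ (65 * m) * Real.exp (-(130 * m)) :=
          mul_le_mul_of_nonneg_left hexp (by positivity)
      _ = (4 * Real.exp (-2)) ^ (65 * m) := by rw [h1, mul_pow]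
      _ ≤ (4 / 7) ^ (65 * m) := pow_le_pow_left₀ (by positivity) h2 _
      _ ≤ (4 / 7) ^ 4 := pow_le_pow_of_le_one (by norm_num) (by norm_num) (by omega)
      _ ≤ _ := by norm_num
  have hsecond : (4 : ℝ) ^ (65 * m) *
      (((33 * m).choose m : ℝ) / ((2 ^ (30 * m) : ℕ) : ℝ)) ^ 6 ≤ 1 / 4 := by
    have h1 : ((33 * m).choose m : ℝ) / ((2 ^ (30 * m) : ℕ) : ℝ) ≤ (1 / 2) ^ (23 * m) := by
      push_cast
      rw [div_le_iff₀ hq]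
      have h2 : ((33 * m).choose m : ℝ) ≤ 2 ^ (7 * m) := by
        exact_mod_cast choose_thirtyThree_mul_le m
      refine h2.trans (le_of_eq ?_)
      rw [show 30 * m = 23 * m + 7 * m by ring, pow_add, ← mul_assoc, ← mul_pow]
      norm_num
    calc _ ≤ (4 : ℝ) ^ (65 * m) * ((1 / 2) ^ (23 * m)) ^ 6 :=
          mul_le_mul_of_nonneg_left (pow_le_pow_left₀ (by positivity) h1 _) (by positivity)
      _ = (1 / 2 : ℝ) ^ (8 * m) := by
          rw [← pow_mul, show 23 * m * 6 = 2 * (65 * m) + 8 * m by ring, pow_add, ← mul_assoc,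
            pow_mul (1 / 2 : ℝ) 2 (65 * m), ← mul_pow]
          norm_num
      _ ≤ (1 / 2 : ℝ) ^ 2 := pow_le_pow_of_le_one (by norm_num) (by norm_num) (by omega)
      _ ≤ _ := by norm_num
  linarith

/-! ### The separating family -/

theorem card_filter_interval {N : ℕ} {G W : Finset (Fin N)} (h : G ⊆ W) (k : ℕ) :
    (W \ G).card.choose k ≤
      (Finset.univ.filter fun Z => G ⊆ Z ∧ Z ⊆ W ∧ Z.card = G.card + k).card := by
  rw [← Finset.card_powersetCard]
  refine Finset.card_le_card_of_injOn (fun T => G ∪ T) ?_ ?_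
  · intro T hT
    obtain ⟨h1, h2⟩ := Finset.mem_powersetCard.1 hT
    have hd : Disjoint G T := Finset.disjoint_right.2 fun x hx => (Finset.mem_sdiff.1 (h1 hx)).2
    simp only [Finset.coe_filter, Finset.mem_univ, true_and, Set.mem_ofPred_eq]
    refine ⟨Finset.subset_union_left, Finset.union_subset h (h1.trans Finset.sdiff_subset), ?_⟩
    rw [Finset.card_union_of_disjoint hd, h2]
  · intro T hT T' hT' heq
    have hd : ∀ T ∈ Finset.powersetCard k (W \ G), (G ∪ T) \ G = T := by
      intro T hT
      refine Finset.union_sdiff_cancel_left ?_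
      exact Finset.disjoint_right.2 fun x hx =>
        (Finset.mem_sdiff.1 ((Finset.mem_powersetCard.1 hT).1 hx)).2
    rw [← hd T hT, ← hd T' hT']
    exact congrArg (· \ G) heq

theorem card_filter_supersets {N : ℕ} (Z : Finset (Fin N)) (k : ℕ) :
    (Finset.univ.filter fun h : Finset (Fin N) => h.card = Z.card + k ∧ Z ⊆ h).card ≤
      (N - Z.card).choose k := by
  have hc : Zᶜ.card = N - Z.card := by rw [Finset.card_compl, Fintype.card_fin]
  rw [← hc, ← Finset.card_powersetCard]
  refine Finset.card_le_card_of_injOn (fun h => h \ Z) ?_ ?_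
  · intro h hh
    simp only [Finset.coe_filter, Finset.mem_univ, true_and, Set.mem_ofPred_eq] at hh
    refine Finset.mem_powersetCard.2 ⟨?_, ?_⟩
    · exact fun x hx => Finset.mem_compl.2 (Finset.mem_sdiff.1 hx).2
    · rw [Finset.card_sdiff_of_subset hh.2]
      omega
  · intro h hh h' hh' heq
    simp only [Finset.coe_filter, Finset.mem_univ, true_and, Set.mem_ofPred_eq] at hh hh'
    rw [← Finset.sdiff_union_of_subset hh.2, ← Finset.sdiff_union_of_subset hh'.2]
    exact congrArg (· ∪ Z) heq

/-- Six subsets of size `16 * m` of a set of size `32 * m`, with large pairwise differences. -/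
theorem exists_spread_subsets {N m : ℕ} {G W : Finset (Fin N)} (hm : 0 < m)
    (h : G ⊆ W) (hG : G.card = 16 * m) (hW : W.card = 48 * m) :
    ∃ T : Fin 6 → Finset (Fin N), (∀ l, G ⊆ T l ∧ T l ⊆ W ∧ (T l).card = 32 * m) ∧
      ∀ l l', l ≠ l' → 33 * m < (T l ∪ T l').card := by
  have hV : (W \ G).card = 32 * m := by
    rw [Finset.card_sdiff_of_subset h]
    omega
  obtain ⟨e, he⟩ := exists_embedding_range hV
  have hemem : ∀ i, e i ∈ W \ G := fun i => by rw [← he]; simp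
  -- Windows of length `16 * m` shifted by `2 * m`: six fit, and two of them cover at least `18 * m`
  -- points. With `G` this is at least `34 * m`, so no `33 * m`-set contains two of the resulting
  -- sets.
  let A : Fin 6 → Finset (Fin (32 * m)) := fun l =>
    Finset.univ.filter fun i => 2 * l * m ≤ (i : ℕ) ∧ (i : ℕ) < 2 * l * m + 16 * m
  have hcardIco : ∀ a b : ℕ, b ≤ 32 * m →
      (Finset.univ.filter fun i : Fin (32 * m) => a ≤ (i : ℕ) ∧ (i : ℕ) < b).card = b - a := by
    intro a b hb
    rw [← Nat.card_Ico, ← Finset.card_map Fin.valEmbedding]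
    congr 1
    ext x
    simp only [Finset.mem_map, Finset.mem_filter, Finset.mem_univ, true_and, Finset.mem_Ico,
      Fin.valEmbedding_apply]
    constructor
    · rintro ⟨i, hi, rfl⟩
      exact hi
    · exact fun hx => ⟨⟨x, by omega⟩, hx, rfl⟩
  have hbound : ∀ l : Fin 6, 2 * (l : ℕ) * m ≤ 10 * m := fun l =>
    Nat.mul_le_mul_right m (by omega)
  have hA : ∀ l, (A l).card = 16 * m := by
    intro l
    have := hbound l
    rw [hcardIco _ _ (by omega)]
    omega
  have hdisj : ∀ B : Finset (Fin (32 * m)), Disjoint G (B.map e) := by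
    intro B
    refine Finset.disjoint_right.2 fun x hx => ?_
    obtain ⟨i, -, rfl⟩ := Finset.mem_map.1 hx
    exact (Finset.mem_sdiff.1 (hemem i)).2
  have hAA : ∀ l l' : Fin 6, l < l' → 18 * m ≤ (A l ∪ A l').card := by
    intro l l' hl
    have h1 := hbound l
    have h2 := hbound l'
    have h3 : 2 * (l : ℕ) * m + 2 * m ≤ 2 * l' * m := by
      rw [← Nat.add_mul]
      exact Nat.mul_le_mul_right m (by omega)
    have h4 : (Finset.univ.filter fun i : Fin (32 * m) => 2 * (l : ℕ) * m ≤ (i : ℕ) ∧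
        (i : ℕ) < 2 * l' * m + 16 * m) ⊆ A l ∪ A l' := by
      intro i hi
      simp only [A, Finset.mem_union, Finset.mem_filter, Finset.mem_univ, true_and] at hi ⊢
      omega
    have h5 := Finset.card_le_card h4
    rw [hcardIco _ _ (by omega)] at h5
    omega
  refine ⟨fun l => G ∪ (A l).map e, fun l => ⟨Finset.subset_union_left, ?_, ?_⟩, ?_⟩
  · refine Finset.union_subset h fun x hx => ?_
    obtain ⟨i, -, rfl⟩ := Finset.mem_map.1 hx
    exact (Finset.mem_sdiff.1 (hemem i)).1
  · rw [Finset.card_union_of_disjoint (hdisj _), Finset.card_map, hA, hG]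
    omega
  · intro l l' hl
    dsimp only
    rw [← Finset.union_union_distrib_left, ← Finset.map_union,
      Finset.card_union_of_disjoint (hdisj _), Finset.card_map, hG]
    have h18 : 18 * m ≤ (A l ∪ A l').card := by
      rcases lt_or_gt_of_ne hl with h1 | h1
      · exact hAA l l' h1
      · rw [Finset.union_comm]
        exact hAA l' l h1
    omega

/-- A family of `33 * m`-sets that meets the middle layer of every interval of dimension `32 * m`
between the layers `17 * m` and `49 * m`, while every interval between the layers `16 * m` and
`48 * m` has an element of its middle layer that is not below a member of the family. -/
theorem exists_separating_family {m : ℕ} (hm : 100 ≤ m) :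
    ∃ H : Finset (Finset (Fin (65 * m))),
      (∀ G W : Finset (Fin (65 * m)), G ⊆ W → G.card = 17 * m → W.card = 49 * m →
        ∃ Z ∈ H, G ⊆ Z ∧ Z ⊆ W ∧ Z.card = 33 * m) ∧
      ∀ G W : Finset (Fin (65 * m)), G ⊆ W → G.card = 16 * m → W.card = 48 * m →
        ∃ T, G ⊆ T ∧ T ⊆ W ∧ T.card = 32 * m ∧ ∀ Z ∈ H, Z.card = 33 * m → ¬ T ⊆ Z := by
  let F := Finset (Fin (65 * m))
  let s₁ : Finset (F × F) := Finset.univ.filter fun p =>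
    p.1 ⊆ p.2 ∧ p.1.card = 17 * m ∧ p.2.card = 49 * m
  let s₂ : Finset (F × F) := Finset.univ.filter fun p =>
    p.1 ⊆ p.2 ∧ p.1.card = 16 * m ∧ p.2.card = 48 * m
  have hT : ∀ p : F × F, ∃ T : Fin 6 → F, p ∈ s₂ →
      (∀ l, p.1 ⊆ T l ∧ T l ⊆ p.2 ∧ (T l).card = 32 * m) ∧
      ∀ l l', l ≠ l' → 33 * m < (T l ∪ T l').card := by
    intro p
    by_cases hp : p ∈ s₂
    · obtain ⟨-, h1, h2, h3⟩ := Finset.mem_filter.1 hp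
      obtain ⟨T, hT⟩ := exists_spread_subsets (by omega) h1 h2 h3
      exact ⟨T, fun _ => hT⟩
    · exact ⟨fun _ => ∅, fun h => absurd h hp⟩
  choose T hT using hT
  have hpairs : ∀ s : Finset (F × F), (s.card : ℝ) ≤ 4 ^ (65 * m) := by
    intro s
    have h1 : s.card ≤ 4 ^ (65 * m) := by
      refine (Finset.card_le_univ s).trans (le_of_eq ?_)
      rw [Fintype.card_prod, Fintype.card_finset, Fintype.card_fin, ← mul_pow]
      norm_num
    exact_mod_cast h1
  obtain ⟨H, hH₁, hH₂⟩ := exists_set_hitting_and_missing s₁ s₂ (q := 2 ^ (30 * m))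
    (s := (32 * m).choose (16 * m)) (D := (33 * m).choose m) (by positivity)
    (fun p => Finset.univ.filter fun Z : F => p.1 ⊆ Z ∧ Z ⊆ p.2 ∧ Z.card = 33 * m)
    (fun p (l : Fin 6) => Finset.univ.filter fun Z : F => Z.card = 33 * m ∧ T p l ⊆ Z)
    (by
      intro p hp
      obtain ⟨-, h1, h2, h3⟩ := Finset.mem_filter.1 hp
      have h4 := card_filter_interval h1 (16 * m)
      rw [Finset.card_sdiff_of_subset h1, h2, h3] at h4
      rwa [show 49 * m - 17 * m = 32 * m by omega, show 17 * m + 16 * m = 33 * m by omega] at h4)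
    (by
      intro p hp l
      have h4 := card_filter_supersets (T p l) m
      rw [((hT p hp).1 l).2.2] at h4
      rwa [show 65 * m - 32 * m = 33 * m by omega, show 32 * m + m = 33 * m by omega] at h4)
    (by
      intro p hp l l' hl
      refine Finset.disjoint_left.2 fun Z h1 h2 => ?_
      obtain ⟨-, h3, h4⟩ := Finset.mem_filter.1 h1
      obtain ⟨-, -, h5⟩ := Finset.mem_filter.1 h2
      have h6 := Finset.card_le_card (Finset.union_subset h4 h5)
      have h7 := (hT p hp).2 l l' hl
      omega)
    (by
      refine lt_of_le_of_lt (add_le_add (mul_le_mul_of_nonneg_right (hpairs _) ?_)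
        (mul_le_mul_of_nonneg_right (hpairs _) ?_)) (four_pow_mul_add_lt_one hm)
      · refine pow_nonneg ?_ _
        rw [sub_nonneg]
        push_cast
        exact div_le_one_of_le₀ (one_le_pow₀ (by norm_num)) (by positivity)
      · positivity)
  refine ⟨H, fun G W h1 h2 h3 => ?_, fun G W h1 h2 h3 => ?_⟩
  · obtain ⟨Z, hZ, hZH⟩ := hH₁ (G, W) (Finset.mem_filter.2 ⟨Finset.mem_univ _, h1, h2, h3⟩)
    exact ⟨Z, hZH, (Finset.mem_filter.1 hZ).2⟩
  · have hp : (G, W) ∈ s₂ := Finset.mem_filter.2 ⟨Finset.mem_univ _, h1, h2, h3⟩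
    obtain ⟨l, hl⟩ := hH₂ (G, W) hp
    obtain ⟨h4, h5, h6⟩ := (hT _ hp).1 l
    exact ⟨T (G, W) l, h4, h5, h6, fun Z hZ hZc hTZ =>
      hl Z (Finset.mem_filter.2 ⟨Finset.mem_univ _, hZc, hTZ⟩) hZ⟩

/-! ### The coloring for the bound `2.02 n` -/

theorem preimage_card_of_subset_map {n N k : ℕ} {x : Fin n ↪ Fin N} {G Z : Finset (Fin N)}
    (hGZ : G ⊆ Z) (hd : ∀ i, x i ∉ G) (hZ : Z ⊆ G ∪ Finset.univ.map x)
    (hk : Z.card = G.card + k) :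
    (Finset.univ.filter fun i => x i ∈ Z).card = k ∧
      Z = G ∪ (Finset.univ.filter fun i => x i ∈ Z).map x := by
  have heq : Z = G ∪ (Finset.univ.filter fun i => x i ∈ Z).map x := by
    ext y
    constructor
    · intro hy
      rcases Finset.mem_union.1 (hZ hy) with h1 | h1
      · exact Finset.mem_union_left _ h1
      · obtain ⟨i, -, rfl⟩ := Finset.mem_map.1 h1
        exact Finset.mem_union_right _ (Finset.mem_map_of_mem x (by simpa using hy))
    · intro hy
      rcases Finset.mem_union.1 hy with h1 | h1
      · exact hGZ h1
      · obtain ⟨i, hi, rfl⟩ := Finset.mem_map.1 h1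
        simpa using hi
  refine ⟨?_, heq⟩
  have hd' : Disjoint G ((Finset.univ.filter fun i => x i ∈ Z).map x) := by
    refine Finset.disjoint_right.2 fun y hy => ?_
    obtain ⟨i, -, rfl⟩ := Finset.mem_map.1 hy
    exact hd i
  have hc := congrArg Finset.card heq
  rw [Finset.card_union_of_disjoint hd', Finset.card_map, hk] at hc
  omega

theorem exists_coloring_avoiding_chain_and_mono {m : ℕ} (hm : 100 ≤ m) :
    ∃ c : BooleanLattice (65 * m) → Color, ¬ HasColoredCopy (redAlternatingChain 4) c ∧
      ¬ HasColoredCopy (monoColoring (BooleanLattice (32 * m)) Color.blue) c ∧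
      ¬ HasColoredCopy (monoColoring (BooleanLattice (32 * m)) Color.red) c := by
  classical
  obtain ⟨H, hH₁, hH₂⟩ := exists_separating_family hm
  let p : Finset (Fin (65 * m)) → Prop := fun Z =>
    16 * m ≤ Z.card ∧ (49 * m < Z.card ∨ ∃ h ∈ H, h.card = 33 * m ∧ Z ⊆ h)
  let c : BooleanLattice (65 * m) → Color := fun Z => if p Z then Color.red else Color.blue
  have hred : ∀ {Z}, c Z = Color.red → p Z := by
    intro Z hZ
    by_contra hcon
    simp [c, hcon] at hZ
  have hblue : ∀ {Z}, c Z = Color.blue → ¬ p Z := by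
    intro Z hZ hcon
    simp [c, hcon] at hZ
  refine ⟨c, ?_, ?_, ?_⟩
  · rintro ⟨φ, hφ⟩
    have h0 := hred (hφ 0)
    have h1 := hblue (hφ 1)
    have h2 := hred (hφ 2)
    have h3 := hblue (hφ 3)
    have h01 : φ 0 ⊆ φ 1 := φ.monotone (show (0 : Fin 4) ≤ 1 by decide)
    have h12 : φ 1 ⊆ φ 2 := φ.monotone (show (1 : Fin 4) ≤ 2 by decide)
    have h23 : φ 2 ⊆ φ 3 := φ.monotone (show (2 : Fin 4) ≤ 3 by decide)
    have c01 := Finset.card_le_card h01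
    have c23 := Finset.card_le_card h23
    -- If the second red set is large, the blue set above it is red as well; if it lies below a
    -- member of `H`, so does the blue set beneath it.
    rcases h2.2 with h4 | ⟨h, hH, hc, hh⟩
    · exact h3 ⟨h2.1.trans c23, Or.inl (h4.trans_le c23)⟩
    · exact h1 ⟨h0.1.trans c01, Or.inr ⟨h, hH, hc, h12.trans hh⟩⟩
  · rintro ⟨φ, hφ⟩
    obtain ⟨x, hx⟩ := exists_trace φ
    set X : Finset (Fin (65 * m)) := Finset.univ.map x with hXdef
    have hXc : X.card = 32 * m := by simp [hXdef]
    have hX : X ⊆ φ Finset.univ := map_trace_subset hx Finset.univ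
    have hXcard := Finset.card_le_card hX
    have htop := hblue (hφ Finset.univ)
    have hle : (φ Finset.univ).card ≤ 49 * m := by
      by_contra hcon
      exact htop ⟨by omega, Or.inl (by omega)⟩
    -- Enlarge the top to size `49 * m`. A member `Z` of `H` between `W \ X` and `W` contains `φ S`
    -- for its trace `S`, and `φ S` has at least `16 * m` elements, so it is red.
    obtain ⟨W, hW1, -, hW2⟩ := Finset.exists_subsuperset_card_eq
      (Finset.subset_univ (φ Finset.univ)) hle (by simp; omega)
    have hXW := hX.trans hW1
    have hGc : (W \ X).card = 17 * m := by
      rw [Finset.card_sdiff_of_subset hXW]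
      omega
    obtain ⟨Z, hZH, hGZ, hZW, hZc⟩ := hH₁ (W \ X) W Finset.sdiff_subset hGc hW2
    obtain ⟨hS, hZeq⟩ := preimage_card_of_subset_map (x := x) (k := 16 * m) hGZ
      (fun i hi => (Finset.mem_sdiff.1 hi).2 (Finset.mem_map_of_mem x (Finset.mem_univ i)))
      (by rw [Finset.sdiff_union_of_subset hXW]; exact hZW) (by omega)
    set S := Finset.univ.filter fun i => x i ∈ Z with hSdef
    have hlow := Finset.card_le_card (map_trace_subset hx S)
    rw [Finset.card_map] at hlow
    refine hblue (hφ S) ⟨by omega, Or.inr ⟨Z, hZH, hZc, fun y hy => ?_⟩⟩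
    have hyW : y ∈ W := hW1 (φ.monotone (Finset.subset_univ S) hy)
    by_cases hyX : y ∈ X
    · obtain ⟨i, -, rfl⟩ := Finset.mem_map.1 hyX
      have := (hx S i).1 hy
      simpa [hSdef] using this
    · exact hGZ (Finset.mem_sdiff.2 ⟨hyW, hyX⟩)
  · rintro ⟨φ, hφ⟩
    obtain ⟨x, hx⟩ := exists_trace φ
    -- Dually, shrink the bottom to size `16 * m`. The set `T` found above `G` is not below `H` and
    -- lies in `φ S`, which misses `16 * m` trace points and so has size at most `49 * m`; hence `φ
    -- S` is blue.
    obtain ⟨G, hG, hGc⟩ := Finset.exists_subset_card_eq (hred (hφ ∅)).1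
    have hxG : ∀ i, x i ∉ G := fun i hi => by simpa using (hx ∅ i).1 (hG hi)
    have hd : Disjoint G (Finset.univ.map x) := by
      refine Finset.disjoint_right.2 fun y hy => ?_
      obtain ⟨i, -, rfl⟩ := Finset.mem_map.1 hy
      exact hxG i
    obtain ⟨T, hGT, hTW, hTc, hT⟩ := hH₂ G (G ∪ Finset.univ.map x) Finset.subset_union_left hGc (by
      rw [Finset.card_union_of_disjoint hd, hGc, Finset.card_map, Finset.card_univ,
        Fintype.card_fin]
      omega)
    obtain ⟨hS, hTeq⟩ := preimage_card_of_subset_map (k := 16 * m) hGT hxG hTW (by omega)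
    generalize (Finset.univ.filter fun i => x i ∈ T) = S at hS hTeq
    have hTS : T ⊆ φ S := by
      rw [hTeq]
      exact Finset.union_subset (hG.trans (φ.monotone (Finset.empty_subset S)))
        (map_trace_subset hx S)
    have hup := card_add_card_compl_le hx S
    rw [Finset.card_compl, Fintype.card_fin, hS] at hup
    rcases (hred (hφ S)).2 with h1 | ⟨h, hhH, hhc, hh⟩
    · omega
    · exact hT h hhH hhc (hTS.trans hh)

theorem exists_coloring_avoiding_of_le {N n : ℕ} (hn : 32 * 200 ≤ n)
    (hN : (N : ℝ) ≤ 2.02 * n) :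
    ∃ c : BooleanLattice N → Color, ¬ HasColoredCopy (redAlternatingChain 4) c ∧
      ¬ HasColoredCopy (monoColoring (BooleanLattice n) Color.blue) c ∧
      ¬ HasColoredCopy (monoColoring (BooleanLattice n) Color.red) c := by
  have h1 : 200 ≤ n / 32 := by omega
  obtain ⟨c, hc₁, hc₂, hc₃⟩ := exists_coloring_avoiding_chain_and_mono
    (show 100 ≤ n / 32 by omega)
  have h2 : 32 * (n / 32) ≤ n := Nat.mul_div_le n 32
  -- With `m = n / 32` and `n ≤ 32 * m + 31`, it suffices that `0.36 * m ≥ 62.62`; `m ≥ 200` is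
  -- ample.
  have h3 : N ≤ 65 * (n / 32) := by
    have h4 : n ≤ 32 * (n / 32) + 31 := by omega
    have h5 : (n : ℝ) ≤ 32 * (n / 32 : ℕ) + 31 := by exact_mod_cast h4
    have h6 : (200 : ℝ) ≤ (n / 32 : ℕ) := by exact_mod_cast h1
    have h7 : (N : ℝ) ≤ 65 * (n / 32 : ℕ) := by linarith
    exact_mod_cast h7
  refine ⟨fun Z => c (booleanLatticeCastLE h3 Z), fun h => hc₁ h.comp, fun h => hc₂ ?_,
    fun h => hc₃ ?_⟩
  · exact hasColoredCopy_mono_of_le h2 h.comp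
  · exact hasColoredCopy_mono_of_le h2 h.comp

/-! ### Assembly of the bounds -/

theorem mainTheorem3 :
    (∀ n : ℕ,
      posetErdosHajnal (redAlternatingChain 2) n = 2 * n ∧
      posetErdosHajnal (redAlternatingChain 3) n = 2 * n) ∧
    (∃ n₀ : ℕ, ∀ t : ℕ, 4 ≤ t → ∀ n : ℕ, n₀ ≤ n →
      (2.02 : ℝ) * (n : ℝ) < (posetErdosHajnal (redAlternatingChain t) n : ℝ) ∧
      posetErdosHajnal (redAlternatingChain t) n ≤ (t - 1) * n) ∧
    (∃ n₀ : ℕ, ∀ n : ℕ, n₀ ≤ n →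
      (2.02 : ℝ) * (n : ℝ) < (posetRamsey (BooleanLattice n) (BooleanLattice n) : ℝ)) := by
  refine ⟨fun n => ⟨?_, ?_⟩, ⟨32 * 200, fun t ht n hn => ⟨?_, ?_⟩⟩, 32 * 200, fun n hn => ?_⟩
  · have h2 : ∀ c : BooleanLattice (2 * n) → Color,
        HasColoredCopy (redAlternatingChain 2) c ∨
        HasColoredCopy (monoColoring (BooleanLattice n) Color.blue) c ∨
        HasColoredCopy (monoColoring (BooleanLattice n) Color.red) c := fun c =>
      (hasColoredCopy_redAlternatingChain_or_mono 0 n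
        (fun Z => c (booleanLatticeCastLE (by simp) Z))).imp
        (fun h => hasColoredCopy_chain_of_le (t := 3) (by norm_num) h.comp)
        (Or.imp (fun h => h.comp) fun h => h.comp)
    exact le_antisymm (Nat.sInf_le h2) (two_mul_le_posetErdosHajnal le_rfl n ⟨_, h2⟩)
  · refine le_antisymm ((posetErdosHajnal_redAlternatingChain_le 0 n).trans (by simp)) ?_
    exact two_mul_le_posetErdosHajnal (by norm_num) n
      ⟨_, hasColoredCopy_redAlternatingChain_or_mono 0 n⟩
  · obtain ⟨s, rfl⟩ := Nat.exists_eq_add_of_le' (show 3 ≤ t by omega)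
    have hmem := Nat.sInf_mem (s := {N : ℕ | ∀ c : BooleanLattice N → Color,
      HasColoredCopy (redAlternatingChain (s + 3)) c ∨
      HasColoredCopy (monoColoring (BooleanLattice n) Color.blue) c ∨
      HasColoredCopy (monoColoring (BooleanLattice n) Color.red) c})
      ⟨_, hasColoredCopy_redAlternatingChain_or_mono s n⟩
    by_contra! hcon
    obtain ⟨c, hc₁, hc₂, hc₃⟩ := exists_coloring_avoiding_of_le hn hcon
    rcases hmem c with h | h | h
    exacts [hc₁ (hasColoredCopy_chain_of_le ht h), hc₂ h, hc₃ h]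
  · obtain ⟨s, rfl⟩ := Nat.exists_eq_add_of_le' (show 3 ≤ t by omega)
    exact posetErdosHajnal_redAlternatingChain_le s n
  · have hmem := Nat.sInf_mem (s := {N : ℕ | ∀ c : BooleanLattice N → Color,
      HasColoredCopy (monoColoring (BooleanLattice n) Color.blue) c ∨
      HasColoredCopy (monoColoring (BooleanLattice n) Color.red) c}) (exists_posetRamsey_bound n)
    by_contra! hcon
    obtain ⟨c, -, hc₂, hc₃⟩ := exists_coloring_avoiding_of_le hn hcon
    rcases hmem c with h | h
    exacts [hc₂ h, hc₃ h]
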